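/- Let $G$ be a group of finite Morley rank, that is, a group with a first-order structure in which the group law is definable and whose definable sets (with parameters, and allowing quotients by definable equivalence relations) carry an $\mathbb{N}$-valued rank satisfying the Borovik–Poizat axioms. Suppose that $G$ has a Sylow $2$-subgroup $S$ which is a (possibly trivial) $2$-torus, i.e. $S\simeq (\mathbb{Z}_{2^\infty})^d$ for some integer $d\geq 0$, and which is central in $G$. Let $\alpha$ be a definable automorphism of $G$ with $\alpha^2=1$. Write $[g,\alpha]=g^{-1}g^\alpha$, $G^+=C_G(\alpha)=\{g\in G: g^\alpha=g\}$ and $\{G,\alpha\}=\{[g,\alpha]:g\in G\}$. Let $[S,\alpha]$ be the subgroup generated by all $[s,\alpha]$ with $s\in S$; for a subset $X$ let $I(X)$ be the set of elements of order $2$ in $X$, and for a subgroup $H$ let $\Omega_2(H)$ be the subgroup generated by $I(H)$. Then: 1. $G=G^+\cdot\{G,\alpha\}$; 2. for every $g\in G$, the fibre $\{(a,x)\in G^+\times\{G,\alpha\}: ax=g\}$ of the product map is in bijection with $\Omega_2([S,\alpha])$; 3. $I(\{G,\alpha\})\cup\{1\}=\Omega_2([S,\alpha])$; 4. if $G$ is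 connected (has no proper definable subgroup of finite index), then $G=(G^+)^\circ\cdot\{G,\alpha\}$, where $(G^+)^\circ$ is the intersection of all definable subgroups of finite index in $G^+$. -/

import Mathlib

open scoped Pointwise

universe u v w

namespace FMR

/-! ### Definable sets, interpretable sets, and rank

`G` carries a first-order structure in a language `L`; definability always means definability with
parameters, and is Mathlib's `Set.Definable` over the parameter set `Set.univ`. -/

section Rank

/-- A sort of imaginaries of the `L`-structure `G`: the quotient of a finite Cartesian power `G ^ n`
by a definable equivalence relation. -/
structure ImagSort (L : FirstOrder.Language.{u, v}) (G : Type w) [L.Structure G] where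
  /-- the exponent `n` of the power `G ^ n` -/
  arity : ℕ
  /-- the equivalence relation on `G ^ n` -/
  rel : Setoid (Fin arity → G)
  definable_rel : (Set.univ : Set G).Definable L
    {v : Fin arity ⊕ Fin arity → G | rel (fun i => v (Sum.inl i)) (fun i => v (Sum.inr i))}

variable {L : FirstOrder.Language.{u, v}} {G : Type w} [L.Structure G]

/-- The elements of the sort, that is, the quotient set `G ^ n / E`. -/
def ImagSort.Pt (s : ImagSort L G) : Type w := Quotient s.rel

/-- The class in the sort of a tuple. -/
def ImagSort.cls (s : ImagSort L G) (x : Fin s.arity → G) : s.Pt := Quotient.mk s.rel x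

/-- A subset of `G ^ n / E` is definable if its preimage in `G ^ n` is. As `s` and `A` vary, these
are the definable sets of the structure "with quotients allowed" (the interpretable sets). -/
def ImagSort.DefSet (s : ImagSort L G) (A : Set s.Pt) : Prop :=
  (Set.univ : Set G).Definable L {x : Fin s.arity → G | s.cls x ∈ A}

/-- The restriction of `f` to the subset `A` is a definable function: its graph is definable.
(The values of `f` outside `A` are irrelevant.) -/
def DefFunOn {s t : ImagSort L G} (A : Set s.Pt) (f : s.Pt → t.Pt) : Prop :=
  (Set.univ : Set G).Definable L {v : Fin s.arity ⊕ Fin t.arity → G |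
    s.cls (fun i => v (Sum.inl i)) ∈ A ∧
      f (s.cls (fun i => v (Sum.inl i))) = t.cls (fun i => v (Sum.inr i))}

/-- The Borovik–Poizat rank axioms, for a function `rk` which attaches a natural number to every
non-empty definable subset of every sort (its values on other sets are irrelevant). -/
structure IsRank (rk : (s : ImagSort L G) → Set s.Pt → ℕ) : Prop where
  /-- Monotonicity: `rk A ≥ n + 1` if and only if `A` contains infinitely many pairwise disjoint,
  non-empty, definable subsets of rank at least `n`. -/
  monotonicity : ∀ (s : ImagSort L G) (A : Set s.Pt), s.DefSet A → A.Nonempty → ∀ n : ℕ,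
    (n + 1 ≤ rk s A ↔ ∃ B : ℕ → Set s.Pt,
      (∀ i j, i ≠ j → Disjoint (B i) (B j)) ∧
      ∀ i, s.DefSet (B i) ∧ (B i).Nonempty ∧ B i ⊆ A ∧ n ≤ rk s (B i))
  /-- Definability: for a definable function, the set of points whose fibre is non-empty and of
  rank `n` is definable. -/
  definability : ∀ (s t : ImagSort L G) (A : Set s.Pt) (f : s.Pt → t.Pt),
    s.DefSet A → DefFunOn A f → ∀ n : ℕ,
      t.DefSet {b | (A ∩ f ⁻¹' {b}).Nonempty ∧ rk s (A ∩ f ⁻¹' {b}) = n}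
  /-- Additivity: if all fibres of a definable function with domain `A ≠ ∅` over its image have
  rank `n`, then the rank of `A` is that of the image plus `n`. -/
  additivity : ∀ (s t : ImagSort L G) (A : Set s.Pt) (f : s.Pt → t.Pt),
    s.DefSet A → A.Nonempty → DefFunOn A f → ∀ n : ℕ,
      (∀ b ∈ f '' A, rk s (A ∩ f ⁻¹' {b}) = n) → rk s A = rk t (f '' A) + n
  /-- Elimination of infinite quantifiers: the finite fibres of a definable function have bounded
  cardinality. -/
  elimination : ∀ (s t : ImagSort L G) (A : Set s.Pt) (f : s.Pt → t.Pt),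
    s.DefSet A → DefFunOn A f →
      ∃ m : ℕ, ∀ b : t.Pt, (A ∩ f ⁻¹' {b}).Finite → (A ∩ f ⁻¹' {b}).ncard ≤ m

variable (L G) in
/-- A group of finite Morley rank: a group `G` with a first-order structure in which the group law
is definable (an "extended group structure"), and whose definable sets, quotients allowed, carry an
integer-valued dimension function obeying the rank axioms. -/
structure IsGroupOfFiniteMorleyRank [Group G] : Prop where
  definable_mul : (Set.univ : Set G).Definable L {v : Fin 3 → G | v 0 * v 1 = v 2}
  exists_rank : ∃ rk : (s : ImagSort L G) → Set s.Pt → ℕ, IsRank rk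

end Rank

/-! ### Connectedness -/

section Connected

variable (L : FirstOrder.Language.{u, v}) {G : Type w} [L.Structure G] [Group G]

/-- A definable subgroup. -/
def DefSubgroup (H : Subgroup G) : Prop := (Set.univ : Set G).Definable₁ L (H : Set G)

/-- The connected component `H°` of a definable subgroup `H`: the intersection of all definable
subgroups of finite index in `H`. -/
def component (H : Subgroup G) : Subgroup G :=
  sInf {K : Subgroup G | DefSubgroup L K ∧ K ≤ H ∧ K.relIndex H ≠ 0}

variable (G) in
/-- `G` is connected: it has no proper definable subgroup of finite index. -/
def IsConnectedGroup : Prop := ∀ K : Subgroup G, DefSubgroup L K → K.index ≠ 0 → K = ⊤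

end Connected

/-! ### Group-theoretic notions -/

section Groups

/-- The Prüfer `2`-group, as the group of complex roots of unity of order a power of `2`. -/
abbrev PruferTwo : Subgroup ℂˣ := CommGroup.primaryComponent ℂˣ 2

/-- A `2`-torus: a direct sum of finitely many (possibly zero) copies of the Prüfer `2`-group. -/
def IsTwoTorus (T : Type*) [Group T] : Prop := ∃ d : ℕ, Nonempty (T ≃* (Fin d → PruferTwo))

variable {G : Type*} [Group G]

/-- `G⁺ = C_G(α)`, the subgroup of fixed points of `α`. -/
def fixedPts (α : G ≃* G) : Subgroup G where
  carrier := {g | α g = g}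
  mul_mem' := by
    intro a b ha hb
    simp only [Set.mem_ofPred_eq] at ha hb ⊢
    rw [map_mul, ha, hb]
  one_mem' := map_one α
  inv_mem' := by
    intro a ha
    simp only [Set.mem_ofPred_eq] at ha ⊢
    rw [map_inv, ha]

/-- `{G, α} = {[g, α] : g ∈ G}` where `[g, α] = g⁻¹ g^α`; in general only a subset. -/
def commSet (α : G ≃* G) : Set G := {x | ∃ g : G, x = g⁻¹ * α g}

/-- `[H, α]`, the subgroup generated by the commutators `[h, α] = h⁻¹ h^α` with `h ∈ H`. -/
def commSubgroup (H : Subgroup G) (α : G ≃* G) : Subgroup G :=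
  Subgroup.closure {x | ∃ h ∈ H, x = h⁻¹ * α h}

/-- `I(X)`, the set of involutions (elements of order exactly `2`) lying in `X`. -/
def involutions (X : Set G) : Set G := {x | x ∈ X ∧ orderOf x = 2}

/-- `Ω₂(H)`, the subgroup generated by the involutions of `H`. -/
def omegaTwo (H : Subgroup G) : Subgroup G := Subgroup.closure (involutions (H : Set G))

end Groups

end FMR

/-! The crux is that every `x` in `{G, α}` has a square root in `{G, α}`, unique up to `Ω₂([S, α])`.
Given this, write `[g, α] = y²`; since `α` inverts `y`, the element `g * y` is fixed, and `g = (g *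
y) * y⁻¹`. Conversely `[a * x, α] = x⁻²` for `a` fixed and `x` in `{G, α}`, so two factorizations of
one element have second factors with equal squares.

Roots come from the descending chain condition on definable subgroups. The double centralizer of `x`
is definable and abelian, and so is its part inverted by `α`; the chain of its `2^j`-th powers
stops, hence `x ^ 2^j = h ^ 2^(j+2)` for some inverted `h` (`exists_eq_mul_pow_four`). Then `x *
h⁻⁴` is a `2`-element, so lies in the central `S`, and it is again a commutator. The same device
inside the fixed points gives `{G, α} ∩ S = [S, α]` (`mem_commSubgroup_of_mem_commSet`), which also
identifies the involutions of `{G, α}`. Divisibility of the torus extracts the remaining root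
(`exists_mul_self_eq`); uniqueness is `exists_eq_mul_of_mul_self_eq`.

For connected `G`, finitely many translates of `Y = (G⁺)° · {G, α}` cover `G`, and likewise for `a •
Y`. Two such definable sets meet (`IsConnectedGroup.inter_nonempty`), and for `a` fixed, uniqueness
of factorizations puts `a` in `(G⁺)° · Ω₂([S, α])`, whose second factor is absorbed by `{G, α}`. -/

namespace FMR

/-! ### Closure properties of definable sets and functions. -/

section Definability

open Set

variable {L : FirstOrder.Language.{u, v}} {G : Type w} [L.Structure G] {ι : Type*}

theorem definable_exists {P : (ι → G) → G → Prop}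
    (h : (univ : Set G).Definable L
      {v : ι ⊕ Unit → G | P (fun i => v (Sum.inl i)) (v (Sum.inr ()))}) :
    (univ : Set G).Definable L {v : ι → G | ∃ x, P v x} := by
  convert! Definable.exists_of_finite h using 1
  ext v
  exact ⟨fun ⟨x, hx⟩ => ⟨fun _ => x, hx⟩, fun ⟨x, hx⟩ => ⟨x (), hx⟩⟩

theorem definable_forall {P : (ι → G) → G → Prop}
    (h : (univ : Set G).Definable L
      {v : ι ⊕ Unit → G | P (fun i => v (Sum.inl i)) (v (Sum.inr ()))}) :
    (univ : Set G).Definable L {v : ι → G | ∀ x, P v x} := by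
  convert! Definable.forall_of_finite h using 1
  ext v
  exact ⟨fun hx x => hx (x ()), fun hx x => hx (fun _ => x)⟩

theorem definable_imp {P Q : (ι → G) → Prop} (hP : (univ : Set G).Definable L {v | P v})
    (hQ : (univ : Set G).Definable L {v | Q v}) :
    (univ : Set G).Definable L {v | P v → Q v} := by
  convert! hP.compl.union hQ using 1
  ext v
  simp [imp_iff_not_or]

theorem definable_mem {X : Set G} (hX : (univ : Set G).Definable₁ L X) {f : (ι → G) → G}
    (hf : (univ : Set G).DefinableFun L f) : (univ : Set G).Definable L {v | f v ∈ X} :=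
  Definable.preimage_map (F := fun v _ => f v) (fun _ => hf) hX

theorem definableFun_apply [Finite ι] {α : G → G}
    (hα : (univ : Set G).Definable₂ L {p : G × G | α p.1 = p.2}) {f : (ι → G) → G}
    (hf : (univ : Set G).DefinableFun L f) :
    (univ : Set G).DefinableFun L (fun v => α (f v)) :=
  -- The graph of the composite is a preimage of the graph of `α`; the coordinate `none` holds the
  -- value.
  Definable.preimage_map (F := fun (w : Option ι → G) => ![f (fun i => w (some i)), w none])
    (fun i => by
      fin_cases i
      · exact DefinableFun.comp (g := fun (w : Option ι → G) i => w (some i))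
          (fun i => DefinableFun.proj L) hf
      · exact DefinableFun.proj L) hα

theorem definableFun_const (a : G) : (univ : Set G).DefinableFun L (fun _ : ι → G => a) :=
  L.definableFun_const ι (mem_univ a)

theorem definable₁_singleton (g : G) : (univ : Set G).Definable₁ L {g} :=
  Definable.singleton_of_mem L (mem_univ g)

end Definability

/-! ### Definability of sets built from the group law and from `α`. -/

section Group

open Set

variable {L : FirstOrder.Language.{u, v}} {G : Type w} [Group G] [L.Structure G] {ι : Type*}
  [Finite ι]

theorem definableFun_mul (hmul : (univ : Set G).Definable L {v : Fin 3 → G | v 0 * v 1 = v 2})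
    {f g : (ι → G) → G} (hf : (univ : Set G).DefinableFun L f)
    (hg : (univ : Set G).DefinableFun L g) :
    (univ : Set G).DefinableFun L (fun v => f v * g v) :=
  Definable.preimage_map
    (F := fun (w : Option ι → G) => ![f (fun i => w (some i)), g (fun i => w (some i)), w none])
    (fun i => by
      fin_cases i
      · exact DefinableFun.comp (g := fun (w : Option ι → G) i => w (some i))
          (fun i => DefinableFun.proj L) hf
      · exact DefinableFun.comp (g := fun (w : Option ι → G) i => w (some i))
          (fun i => DefinableFun.proj L) hg
      · exact DefinableFun.proj L) hmul

theorem definableFun_inv (hmul : (univ : Set G).Definable L {v : Fin 3 → G | v 0 * v 1 = v 2})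
    {f : (ι → G) → G} (hf : (univ : Set G).DefinableFun L f) :
    (univ : Set G).DefinableFun L (fun v => (f v)⁻¹) := by
  refine definableFun_apply (α := fun x => x⁻¹) ?_ hf
  rw [Definable₂]
  convert! (definableFun_mul hmul (DefinableFun.proj L (i := (0 : Fin 2)))
    (DefinableFun.proj L (i := 1))).ofPred_eq (definableFun_const (1 : G)) using 1
  ext v
  exact inv_eq_iff_mul_eq_one

theorem definableFun_pow (hmul : (univ : Set G).Definable L {v : Fin 3 → G | v 0 * v 1 = v 2})
    {f : (ι → G) → G} (hf : (univ : Set G).DefinableFun L f) (n : ℕ) :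
    (univ : Set G).DefinableFun L (fun v => f v ^ n) := by
  induction n with
  | zero => simpa using definableFun_const (1 : G)
  | succ n ih => simpa only [pow_succ] using definableFun_mul hmul ih hf

theorem definable₁_mul (hmul : (univ : Set G).Definable L {v : Fin 3 → G | v 0 * v 1 = v 2})
    {X Y : Set G} (hX : (univ : Set G).Definable₁ L X) (hY : (univ : Set G).Definable₁ L Y) :
    (univ : Set G).Definable₁ L (X * Y) := by
  have h : (univ : Set G).Definable L {v : Fin 1 → G | ∃ x, ∃ y, (x ∈ X ∧ y ∈ Y) ∧ x * y = v 0} := by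
    refine definable_exists (definable_exists ?_)
    exact ((definable_mem hX (DefinableFun.proj L)).inter
      (definable_mem hY (DefinableFun.proj L))).inter
      ((definableFun_mul hmul (DefinableFun.proj L) (DefinableFun.proj L)).ofPred_eq
        (DefinableFun.proj L))
  rw [Definable₁]
  convert! h using 1
  ext v
  simp [Set.mem_mul, and_assoc]

theorem definable₁_smul (hmul : (univ : Set G).Definable L {v : Fin 3 → G | v 0 * v 1 = v 2})
    {X : Set G} (hX : (univ : Set G).Definable₁ L X) (g : G) :
    (univ : Set G).Definable₁ L (g • X) := by
  rw [Definable₁]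
  convert! definable_mem hX (definableFun_mul hmul (definableFun_const g⁻¹)
    (DefinableFun.proj L (i := (0 : Fin 1)))) using 1
  ext v
  simp [Set.mem_smul_set_iff_inv_smul_mem]

theorem definable₁_commSet
    (hmul : (univ : Set G).Definable L {v : Fin 3 → G | v 0 * v 1 = v 2})
    {α : G ≃* G} (hα : (univ : Set G).Definable₂ L {p : G × G | α p.1 = p.2}) :
    (univ : Set G).Definable₁ L (commSet α) := by
  have h : (univ : Set G).Definable L {v : Fin 1 → G | ∃ g, v 0 = g⁻¹ * α g} :=
    definable_exists ((DefinableFun.proj L).ofPred_eq (definableFun_mul hmul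
      (definableFun_inv hmul (DefinableFun.proj L)) (definableFun_apply hα (DefinableFun.proj L))))
  exact h

theorem definable₁_centralizer
    (hmul : (univ : Set G).Definable L {v : Fin 3 → G | v 0 * v 1 = v 2})
    {X : Set G} (hX : (univ : Set G).Definable₁ L X) :
    DefSubgroup L (Subgroup.centralizer X) := by
  have h : (univ : Set G).Definable L {v : Fin 1 → G | ∀ x, x ∈ X → x * v 0 = v 0 * x} :=
    definable_forall (definable_imp (definable_mem hX (DefinableFun.proj L))
      ((definableFun_mul hmul (DefinableFun.proj L) (DefinableFun.proj L)).ofPred_eq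
        (definableFun_mul hmul (DefinableFun.proj L) (DefinableFun.proj L))))
  exact h

theorem defSubgroup_fixedPts {α : G ≃* G}
    (hα : (univ : Set G).Definable₂ L {p : G × G | α p.1 = p.2}) :
    DefSubgroup L (fixedPts α) :=
  (definableFun_apply hα (DefinableFun.proj L)).ofPred_eq
    (DefinableFun.proj L (i := (0 : Fin 1)))

theorem definable₁_inverted
    (hmul : (univ : Set G).Definable L {v : Fin 3 → G | v 0 * v 1 = v 2}) {α : G ≃* G}
    (hα : (univ : Set G).Definable₂ L {p : G × G | α p.1 = p.2}) :
    (univ : Set G).Definable₁ L {z : G | α z = z⁻¹} :=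
  (definableFun_apply hα (DefinableFun.proj L)).ofPred_eq
    (definableFun_inv hmul (DefinableFun.proj L (i := (0 : Fin 1))))

theorem definable₁_pow (hmul : (univ : Set G).Definable L {v : Fin 3 → G | v 0 * v 1 = v 2})
    {X : Set G} (hX : (univ : Set G).Definable₁ L X) (n : ℕ) :
    (univ : Set G).Definable₁ L ((fun x => x ^ n) '' X) := by
  have h : (univ : Set G).Definable L {v : Fin 1 → G | ∃ x, x ∈ X ∧ x ^ n = v 0} :=
    definable_exists ((definable_mem hX (DefinableFun.proj L)).inter
      ((definableFun_pow hmul (DefinableFun.proj L) n).ofPred_eq (DefinableFun.proj L)))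
  exact h

theorem defSubgroup_inf {H K : Subgroup G} (hH : DefSubgroup L H) (hK : DefSubgroup L K) :
    DefSubgroup L (H ⊓ K) :=
  hH.inter hK

end Group

/-! ### Rank computed from the class of definable sets alone. -/

section Big

open Set Function

/-- Relative to the class `D` of definable sets, `A` is a non-empty definable set of rank at
least `n`, the rank being the one generated by the monotonicity axiom. -/
def Big {P : Type*} (D : Set P → Prop) : ℕ → Set P → Prop
  | 0, A => D A ∧ A.Nonempty
  | n + 1, A => D A ∧ ∃ B : ℕ → Set P, Pairwise (Disjoint on B) ∧ ∀ i, Big D n (B i) ∧ B i ⊆ A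

variable {P Q : Type*} {D : Set P → Prop} {D' : Set Q → Prop}

theorem Big.def {n : ℕ} {A : Set P} (h : Big D n A) : D A := by
  cases n with
  | zero => exact h.1
  | succ n => exact h.1

theorem Big.nonempty {n : ℕ} {A : Set P} (h : Big D n A) : A.Nonempty := by
  induction n generalizing A with
  | zero => exact h.2
  | succ n ih =>
    obtain ⟨-, B, -, hB⟩ := h
    exact (ih (hB 0).1).mono (hB 0).2

theorem Big.mono {n : ℕ} {A A' : Set P} (h : Big D n A) (hA : A ⊆ A') (hA' : D A') :
    Big D n A' := by
  cases n with
  | zero => exact ⟨hA', h.2.mono hA⟩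
  | succ n =>
    obtain ⟨-, B, hd, hB⟩ := h
    exact ⟨hA', B, hd, fun i => ⟨(hB i).1, (hB i).2.trans hA⟩⟩

theorem Big.of_succ {n : ℕ} {A : Set P} (h : Big D (n + 1) A) : Big D n A := by
  obtain ⟨hA, B, -, hB⟩ := h
  exact (hB 0).1.mono (hB 0).2 hA

/-- `Big` refers only to definable subsets, so it passes along any injection preserving
definability; this compares `G` with its sorts. -/
theorem Big.image {n : ℕ} {A : Set P} {e : P → Q} (h : Big D n A) (he : InjOn e A)
    (hD : ∀ X ⊆ A, D X → D' (e '' X)) : Big D' n (e '' A) := by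
  induction n generalizing A with
  | zero => exact ⟨hD A Subset.rfl h.1, h.2.image e⟩
  | succ n ih =>
    obtain ⟨hA, B, hd, hB⟩ := h
    refine ⟨hD A Subset.rfl hA, fun i => e '' B i, fun i j hij => ?_, fun i =>
      ⟨ih (hB i).1 (he.mono (hB i).2) fun X hX => hD X (hX.trans (hB i).2),
        image_mono (hB i).2⟩⟩
    exact (hd hij).image he (hB i).2 (hB j).2

theorem big_succ_of_infinite {n : ℕ} {A : Set P} {ι : Type*} [Infinite ι] (hA : D A)
    (B : ι → Set P) (hd : Pairwise (Disjoint on B)) (hB : ∀ i, Big D n (B i) ∧ B i ⊆ A) :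
    Big D (n + 1) A :=
  ⟨hA, fun i => B (Infinite.natEmbedding ι i),
    fun _ _ hij => hd ((Infinite.natEmbedding ι).injective.ne hij), fun _ => hB _⟩

/-- Of infinitely many disjoint pieces of the union, infinitely many are large inside the same one
of `A`, `B`. The induction needs the statement for all definable `C ⊆ A ∪ B`, since it descends to
the pieces. -/
theorem Big.of_union (hD : ∀ X Y, D X → D Y → D (X ∩ Y)) {n : ℕ} {A B : Set P}
    (h : Big D n (A ∪ B)) (hA : D A) (hB : D B) : Big D n A ∨ Big D n B := by
  suffices H : ∀ C, Big D n C → C ⊆ A ∪ B → Big D n (C ∩ A) ∨ Big D n (C ∩ B) from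
    (H _ h Subset.rfl).imp (fun h => h.mono inter_subset_right hA)
      (fun h => h.mono inter_subset_right hB)
  clear h
  induction n with
  | zero =>
    rintro C ⟨hC, x, hx⟩ hCAB
    exact (hCAB hx).imp (fun h => ⟨hD _ _ hC hA, x, hx, h⟩) (fun h => ⟨hD _ _ hC hB, x, hx, h⟩)
  | succ n ih =>
    rintro C ⟨hC, E, hd, hE⟩ hCAB
    have key : ∀ i, Big D n (E i ∩ A) ∨ Big D n (E i ∩ B) :=
      fun i => ih _ (hE i).1 ((hE i).2.trans hCAB)
    have aux : ∀ F, D F → {i | Big D n (E i ∩ F)}.Infinite → Big D (n + 1) (C ∩ F) := by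
      intro F hF hinf
      have := hinf.to_subtype
      refine big_succ_of_infinite (hD _ _ hC hF)
        (fun i : {i | Big D n (E i ∩ F)} => E i ∩ F) (fun i j hij => ?_)
        (fun i => ⟨i.2, inter_subset_inter_left _ (hE i).2⟩)
      exact (hd (Subtype.coe_injective.ne hij)).mono inter_subset_left inter_subset_left
    have huniv : {i | Big D n (E i ∩ A)} ∪ {i | Big D n (E i ∩ B)} = univ :=
      eq_univ_of_forall key
    exact (infinite_union.1 (huniv ▸ infinite_univ)).imp (aux A hA) (aux B hB)

theorem Big.of_biUnion (hD : ∀ X Y, D X → D Y → D (X ∩ Y)) (hU : ∀ X Y, D X → D Y → D (X ∪ Y))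
    (h0 : D ∅) {n : ℕ} {ι : Type*} (s : Finset ι) {A : ι → Set P} (hA : ∀ i, D (A i))
    (h : Big D n (⋃ i ∈ s, A i)) : ∃ i ∈ s, Big D n (A i) := by
  classical
  have hdef : ∀ s : Finset ι, D (⋃ i ∈ s, A i) := by
    intro s
    induction s using Finset.induction_on with
    | empty => simpa using h0
    | insert a s _ ih => simpa using hU _ _ (hA a) ih
  induction s using Finset.induction_on with
  | empty => simpa using h.nonempty
  | insert a s _ ih =>
    rw [Finset.set_biUnion_insert] at h
    rcases h.of_union hD (hA a) (hdef s) with h | h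
    · exact ⟨a, by simp, h⟩
    · obtain ⟨i, hi, h⟩ := ih h
      exact ⟨i, by simp [hi], h⟩

end Big

/-! ### Comparison of `Big` with the axiomatic rank. -/

section Link

open Set Function

variable {L : FirstOrder.Language.{u, v}} {G : Type w} [L.Structure G]

variable (L G) in
/-- The sort `G ^ n` itself. -/
def powSort (n : ℕ) : ImagSort L G where
  arity := n
  rel := ⊥
  definable_rel := by
    have h : (univ : Set G).Definable L
        {v : Fin n ⊕ Fin n → G | ∀ i, v (Sum.inl i) = v (Sum.inr i)} := by
      rw [ofPred_forall]
      exact definable_iInter_of_finite fun i => (DefinableFun.proj L).ofPred_eq (DefinableFun.proj L)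
    convert! h using 1
    ext v
    exact funext_iff

variable (L G) in
/-- The points of the sort `G ^ n` are the `n`-tuples. -/
noncomputable def ptEquiv (n : ℕ) : (Fin n → G) ≃ (powSort L G n).Pt :=
  Equiv.ofBijective (powSort L G n).cls ⟨fun _ _ h => Quotient.exact h, Quotient.mk_surjective⟩

theorem defSet_powSort {n : ℕ} {A : Set (powSort L G n).Pt} :
    (powSort L G n).DefSet A ↔
      (univ : Set G).Definable L {x : Fin n → G | ptEquiv L G n x ∈ A} :=
  Iff.rfl

theorem defFunOn_powSort {m n : ℕ} {A : Set (powSort L G m).Pt}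
    {f : (powSort L G m).Pt → (powSort L G n).Pt} :
    DefFunOn A f ↔ (univ : Set G).Definable L {v : Fin m ⊕ Fin n → G |
      ptEquiv L G m (fun i => v (Sum.inl i)) ∈ A ∧
        f (ptEquiv L G m (fun i => v (Sum.inl i))) = ptEquiv L G n (fun i => v (Sum.inr i))} :=
  Iff.rfl

variable (L G) in
/-- The points of the sort `G ^ 1` are the elements of `G`. -/
noncomputable def ptEquivOne : G ≃ (powSort L G 1).Pt :=
  (Equiv.funUnique (Fin 1) G).symm.trans (ptEquiv L G 1)

theorem ptEquiv_one (x : Fin 1 → G) : ptEquiv L G 1 x = ptEquivOne L G (x 0) := by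
  rw [ptEquivOne, Equiv.trans_apply]
  congr 1
  exact ((Equiv.funUnique (Fin 1) G).symm_apply_apply x).symm

theorem defSet_powSort_one {A : Set (powSort L G 1).Pt} :
    (powSort L G 1).DefSet A ↔ (univ : Set G).Definable₁ L (ptEquivOne L G ⁻¹' A) := by
  rw [defSet_powSort]
  simp only [ptEquiv_one]
  rfl

theorem IsRank.big_iff {rk : (s : ImagSort L G) → Set s.Pt → ℕ} (h : IsRank rk)
    (s : ImagSort L G) (n : ℕ) (A : Set s.Pt) :
    Big s.DefSet n A ↔ s.DefSet A ∧ A.Nonempty ∧ n ≤ rk s A := by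
  induction n generalizing A with
  | zero => simp [Big]
  | succ n ih =>
    constructor
    · intro hA
      refine ⟨hA.def, hA.nonempty, (h.monotonicity s A hA.def hA.nonempty n).2 ?_⟩
      obtain ⟨-, B, hd, hB⟩ := hA
      refine ⟨B, fun i j hij => hd hij, fun i => ?_⟩
      obtain ⟨h1, h2, h3⟩ := (ih _).1 (hB i).1
      exact ⟨h1, h2, (hB i).2, h3⟩
    · rintro ⟨h1, h2, h3⟩
      obtain ⟨B, hd, hB⟩ := (h.monotonicity s A h1 h2 n).1 h3
      exact ⟨h1, B, fun i j hij => hd i j hij, fun i =>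
        ⟨(ih _).2 ⟨(hB i).1, (hB i).2.1, (hB i).2.2.2⟩, (hB i).2.2.1⟩⟩

theorem IsRank.exists_not_big {rk : (s : ImagSort L G) → Set s.Pt → ℕ} (h : IsRank rk) :
    ∃ n, ¬ Big ((univ : Set G).Definable₁ L) n univ := by
  refine ⟨rk _ (ptEquivOne L G '' univ) + 1, fun hb => ?_⟩
  have := ((h.big_iff _ _ _).1 (hb.image (D' := (powSort L G 1).DefSet)
    (ptEquivOne L G).injective.injOn fun X _ hX => by
      rwa [defSet_powSort_one, preimage_image_eq _ (ptEquivOne L G).injective])).2.2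
  omega

/-- For a definable family of definable sets, the parameters of the members of maximal rank form a
definable set. -/
theorem IsRank.definable_big {rk : (s : ImagSort L G) → Set s.Pt → ℕ} (h : IsRank rk)
    {R : Set (Fin 2 → G)} (hR : (univ : Set G).Definable L R) {n : ℕ}
    (hn : ¬ Big ((univ : Set G).Definable₁ L) (n + 1) univ) :
    (univ : Set G).Definable₁ L {g | Big ((univ : Set G).Definable₁ L) n {x | ![g, x] ∈ R}} := by
  set e := ptEquiv L G 2 with he
  set e₁ := ptEquivOne L G with he₁
  -- The members of the family become the fibres of the first projection on `R`, to which the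
  -- definability axiom applies.
  let A : Set (powSort L G 2).Pt := e '' R
  let f : (powSort L G 2).Pt → (powSort L G 1).Pt := fun p => e₁ (e.symm p 0)
  have hA : ∀ x, e x ∈ A ↔ x ∈ R := fun x => e.injective.mem_set_image
  have hf : ∀ x : Fin 2 → G, f (e x) = e₁ (x 0) := fun x => by simp [f]
  have hvec : ∀ (v : Fin 2 → G), ![v 0, v 1] = v := fun v => by
    ext i
    fin_cases i <;> rfl
  have hAdef : (powSort L G 2).DefSet A := by
    rw [defSet_powSort]
    simpa only [← he, hA] using! hR
  have hfdef : DefFunOn A f := by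
    have := (hR.preimage_comp (Sum.inl : Fin 2 → Fin 2 ⊕ Fin 1)).inter
      ((DefinableFun.proj L (i := (Sum.inl 0 : Fin 2 ⊕ Fin 1))).ofPred_eq
        (DefinableFun.proj L (A := (univ : Set G)) (i := (Sum.inr 0 : Fin 2 ⊕ Fin 1))))
    rw [defFunOn_powSort]
    convert! this using 1
    ext v
    simp only [mem_ofPred_eq]
    rw [← he, hA, hf, ptEquiv_one, ← he₁, e₁.injective.eq_iff]
    rfl
  have hfib : ∀ g, A ∩ f ⁻¹' {e₁ g} = e '' {v | v 0 = g ∧ v ∈ R} := by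
    intro g
    ext p
    obtain ⟨y, rfl⟩ := e.surjective p
    rw [e.injective.mem_set_image, mem_inter_iff, hA, mem_preimage, hf, mem_singleton_iff,
      e₁.injective.eq_iff, and_comm]
    rfl
  have hfdef' : ∀ g, (powSort L G 2).DefSet (A ∩ f ⁻¹' {e₁ g}) := by
    intro g
    rw [hfib, defSet_powSort]
    simp only [← he, e.injective.mem_set_image]
    exact ((DefinableFun.proj L).ofPred_eq (definableFun_const g)).inter hR
  have key : ∀ g m, Big ((univ : Set G).Definable₁ L) m {x | ![g, x] ∈ R} ↔
      Big (powSort L G 2).DefSet m (A ∩ f ⁻¹' {e₁ g}) := by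
    intro g m
    have hinj : Injective fun x => e ![g, x] := fun x y hxy => by
      simpa using! congrFun (e.injective hxy) 1
    have himg : A ∩ f ⁻¹' {e₁ g} = (fun x => e ![g, x]) '' {x | ![g, x] ∈ R} := by
      rw [hfib]
      ext p
      obtain ⟨y, rfl⟩ := e.surjective p
      rw [e.injective.mem_set_image]
      constructor
      · rintro ⟨rfl, h2⟩
        exact ⟨y 1, by rwa [mem_ofPred_eq, hvec], congrArg e (hvec y)⟩
      · rintro ⟨x, hx, hxy⟩
        rw [← e.injective hxy]
        exact ⟨rfl, hx⟩
    constructor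
    · intro hb
      rw [himg]
      refine hb.image hinj.injOn fun X _ hX => ?_
      have : (univ : Set G).Definable L {v : Fin 2 → G | v 0 = g ∧ v 1 ∈ X} :=
        ((DefinableFun.proj L).ofPred_eq (definableFun_const g)).inter
          (definable_mem hX (DefinableFun.proj L))
      rw [defSet_powSort]
      convert! this using 1
      ext v
      constructor
      · rintro ⟨x, hx, hxv⟩
        rw [← e.injective hxv]
        exact ⟨rfl, hx⟩
      · rintro ⟨rfl, h1⟩
        exact ⟨v 1, h1, congrArg e (hvec v)⟩
    · intro hb
      have h' := hb.image (D' := (univ : Set G).Definable₁ L) (e := fun p => e.symm p 1) ?_ ?_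
      · rw [himg, image_image] at h'
        simpa using! h'
      · rw [himg]
        rintro _ ⟨x, -, rfl⟩ _ ⟨y, -, rfl⟩ hxy
        simpa using! hxy
      · intro Y hY hD
        rw [himg] at hY
        obtain ⟨Z, -, rfl⟩ := subset_image_iff.1 hY
        rw [defSet_powSort] at hD
        have := Definable.preimage_map (F := fun (v : Fin 1 → G) => ![g, v 0]) (fun i => by
            fin_cases i
            · exact definableFun_const g
            · exact DefinableFun.proj L) hD
        rw [image_image, Definable₁]
        convert! this using 1
        ext v
        have h1 : (fun x => e.symm (e ![g, x]) 1) '' Z = Z := by simp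
        rw [mem_ofPred_eq, h1]
        exact hinj.mem_set_image.symm
  have hdef := defSet_powSort_one.1 (h.definability _ _ A f hAdef hfdef n)
  convert! hdef using 1
  ext g
  simp only [mem_ofPred_eq, mem_preimage]
  rw [key, h.big_iff]
  constructor
  · rintro ⟨-, h1, h2⟩
    refine ⟨h1, le_antisymm ?_ h2⟩
    -- The axiom speaks of rank exactly `n`; since `G` has rank at most `n`, this is the same as
    -- rank at least `n`.
    by_contra! hlt
    refine hn (((key g (n + 1)).2 ((h.big_iff _ _ _).2 ⟨hfdef' g, h1, hlt⟩)).mono (subset_univ _) ?_)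
    exact definable_univ
  · rintro ⟨h1, h2⟩
    exact ⟨hfdef' g, h1, h2.ge⟩

/-- There is a generic definable set which does not contain two disjoint generic definable sets. -/
theorem exists_big_indecomposable {n : ℕ}
    (hn : Big ((univ : Set G).Definable₁ L) n univ)
    (hn' : ¬ Big ((univ : Set G).Definable₁ L) (n + 1) univ) :
    ∃ X : Set G, Big ((univ : Set G).Definable₁ L) n X ∧
      ∀ Y Z : Set G, Y ⊆ X → Z ⊆ X → Big ((univ : Set G).Definable₁ L) n Y →
        Big ((univ : Set G).Definable₁ L) n Z → (Y ∩ Z).Nonempty := by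
  by_contra! hcon
  have hcon' : ∀ X : Set G, ∃ Y Z : Set G, Big ((univ : Set G).Definable₁ L) n X →
      Y ⊆ X ∧ Z ⊆ X ∧ Big ((univ : Set G).Definable₁ L) n Y ∧
        Big ((univ : Set G).Definable₁ L) n Z ∧ Y ∩ Z = ∅ := by
    intro X
    by_cases hX : Big ((univ : Set G).Definable₁ L) n X
    · obtain ⟨Y, Z, h⟩ := hcon X hX
      exact ⟨Y, Z, fun _ => h⟩
    · exact ⟨∅, ∅, fun h => (hX h).elim⟩
  choose Y Z hYZ using hcon'
  -- Iterating `Y` keeps one half of each splitting; the discarded halves `Z` are disjoint and of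
  -- rank `n`, forcing rank `n + 1` on `G`.
  have hbig : ∀ i, Big ((univ : Set G).Definable₁ L) n (Y^[i] univ) := by
    intro i
    induction i with
    | zero => exact hn
    | succ i ih => rw [iterate_succ_apply']; exact (hYZ _ ih).2.2.1
  have hanti : Antitone fun i => Y^[i] univ := antitone_nat_of_succ_le fun i => by
    rw [iterate_succ_apply']
    exact (hYZ _ (hbig i)).1
  refine hn' ⟨definable_univ, fun i => Z (Y^[i] univ), ?_, fun i =>
    ⟨(hYZ _ (hbig i)).2.2.2.1, subset_univ _⟩⟩
  refine (pairwise_disjoint_on _).2 fun a b hab => ?_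
  have h1 : Z (Y^[b] univ) ⊆ Y (Y^[a] univ) := by
    rw [← iterate_succ_apply' Y]
    exact (hYZ _ (hbig b)).2.1.trans (hanti hab)
  exact (disjoint_iff_inter_eq_empty.2 (hYZ _ (hbig a)).2.2.2.2).symm.mono_right h1

end Link

/-! ### Chain condition, generic sets in connected groups, connected components. -/

section Generic

open Set Function

variable {L : FirstOrder.Language.{u, v}} {G : Type w} [Group G] [L.Structure G]

theorem Big.smul (hmul : (univ : Set G).Definable L {v : Fin 3 → G | v 0 * v 1 = v 2}) {n : ℕ}
    {X : Set G} (h : Big ((univ : Set G).Definable₁ L) n X) (g : G) :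
    Big ((univ : Set G).Definable₁ L) n (g • X) :=
  h.image (MulAction.injective g).injOn fun _ _ hY => definable₁_smul hmul hY g

/-- The differences of consecutive terms are disjoint, and each contains a coset of the smaller
term. So if every term has rank at least `n`, every term has rank at least `n + 1`. -/
theorem not_strictAnti_defSubgroup
    (hmul : (univ : Set G).Definable L {v : Fin 3 → G | v 0 * v 1 = v 2})
    (hfin : ∃ n, ¬ Big ((univ : Set G).Definable₁ L) n univ)
    {K : ℕ → Subgroup G} (hK : ∀ i, DefSubgroup L (K i)) : ¬ StrictAnti K := by
  intro hanti
  obtain ⟨N, hN⟩ := hfin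
  have key : ∀ n, ∀ i, Big ((univ : Set G).Definable₁ L) n (K i : Set G) := by
    intro n
    induction n with
    | zero => exact fun i => ⟨hK i, 1, one_mem _⟩
    | succ n ih =>
      intro i
      refine ⟨hK i, fun j => (K (i + j) : Set G) \ K (i + j + 1), ?_, fun j => ?_⟩
      · refine (pairwise_disjoint_on _).2 fun a b hab => ?_
        refine disjoint_left.2 fun x hx hx' => hx.2 ?_
        exact hanti.antitone (by omega : i + a + 1 ≤ i + b) hx'.1
      · obtain ⟨g, hg, hg'⟩ := SetLike.exists_of_lt (hanti (Nat.lt_succ_self (i + j)))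
        refine ⟨((ih (i + j + 1)).smul hmul g).mono ?_ ((hK _).sdiff (hK _)), fun x hx =>
          hanti.antitone (by omega : i ≤ i + j) hx.1⟩
        rintro _ ⟨x, hx, rfl⟩
        exact ⟨mul_mem hg (hanti.antitone (Nat.le_succ _) hx),
          fun h => hg' ((Subgroup.mul_mem_cancel_right _ hx).1 h)⟩
  exact hN ((key N 0).mono (subset_univ _) definable_univ)

theorem exists_minimal_defSubgroup
    (hmul : (univ : Set G).Definable L {v : Fin 3 → G | v 0 * v 1 = v 2})
    (hfin : ∃ n, ¬ Big ((univ : Set G).Definable₁ L) n univ)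
    {𝒮 : Set (Subgroup G)} (h𝒮 : 𝒮.Nonempty) (hdef : ∀ K ∈ 𝒮, DefSubgroup L K) :
    ∃ K ∈ 𝒮, ∀ H ∈ 𝒮, H ≤ K → H = K := by
  by_contra! hcon
  obtain ⟨K₀, hK₀⟩ := h𝒮
  choose! f hf hfle hfne using hcon
  have hmem : ∀ n, f^[n] K₀ ∈ 𝒮 := by
    intro n
    induction n with
    | zero => exact hK₀
    | succ n ih => rw [iterate_succ_apply']; exact hf _ ih
  refine not_strictAnti_defSubgroup hmul hfin (fun n => hdef _ (hmem n))
    (strictAnti_nat_of_succ_lt fun n => ?_)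
  rw [iterate_succ_apply']
  exact lt_of_le_of_ne (hfle _ (hmem n)) (hfne _ (hmem n))

theorem exists_big_maximal (hfin : ∃ n, ¬ Big ((univ : Set G).Definable₁ L) n univ) :
    ∃ n, Big ((univ : Set G).Definable₁ L) n univ ∧
      ¬ Big ((univ : Set G).Definable₁ L) (n + 1) univ := by
  classical
  have h0 : Nat.find hfin ≠ 0 := fun h => by
    have := Nat.find_spec hfin
    rw [h] at this
    exact this ⟨definable_univ, 1, mem_univ _⟩
  obtain ⟨n, hn⟩ := Nat.exists_eq_succ_of_ne_zero h0
  exact ⟨n, not_not.1 (Nat.find_min hfin (by omega)), by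
    have := Nat.find_spec hfin
    rwa [hn] at this⟩

/-- In a connected group, two definable sets each of which covers the group by finitely many
translates have a common point. -/
theorem IsConnectedGroup.inter_nonempty (hG : IsGroupOfFiniteMorleyRank L G)
    (hconn : IsConnectedGroup L G) {Y Z : Set G} (hY : (univ : Set G).Definable₁ L Y)
    (hZ : (univ : Set G).Definable₁ L Z) {s t : Finset G} (hs : ⋃ g ∈ s, g • Y = univ)
    (ht : ⋃ g ∈ t, g • Z = univ) : (Y ∩ Z).Nonempty := by
  have hmul := hG.definable_mul
  obtain ⟨rk, hrk⟩ := hG.exists_rank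
  obtain ⟨n, hn, hn'⟩ := exists_big_maximal hrk.exists_not_big
  have hinter : ∀ A B : Set G, (univ : Set G).Definable₁ L A → (univ : Set G).Definable₁ L B →
    (univ : Set G).Definable₁ L (A ∩ B) := fun A B hA hB => hA.inter hB
  have hunion : ∀ A B : Set G, (univ : Set G).Definable₁ L A → (univ : Set G).Definable₁ L B →
    (univ : Set G).Definable₁ L (A ∪ B) := fun A B hA hB => hA.union hB
  have hempty : (univ : Set G).Definable₁ L (∅ : Set G) := definable_empty
  obtain ⟨X, hX, hdeg⟩ := exists_big_indecomposable hn hn'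
  -- the generic intersections with `X` form a filter base
  have hfilt : ∀ A B : Set G, Big ((univ : Set G).Definable₁ L) n (X ∩ A) →
      Big ((univ : Set G).Definable₁ L) n (X ∩ B) → (univ : Set G).Definable₁ L B →
      Big ((univ : Set G).Definable₁ L) n (X ∩ A ∩ B) := by
    intro A B hA hB hBd
    -- If the part of `X ∩ A` outside `B` were generic, it and `X ∩ B` would be disjoint generic
    -- subsets of `X`.
    have h1 : X ∩ A = (X ∩ A ∩ B) ∪ (X ∩ A) \ B := (inter_union_sdiff _ _).symm
    have hAd := hA.def
    rw [h1] at hA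
    rcases hA.of_union hinter (hAd.inter hBd) (hAd.sdiff hBd) with h | h
    · exact h
    · obtain ⟨x, hx, hx'⟩ := hdeg _ _ (sdiff_subset.trans inter_subset_left) inter_subset_left h hB
      exact (hx.2 hx'.2).elim
  -- the generic stabilizer of `X`
  have hstab_mul : ∀ a b : G, Big ((univ : Set G).Definable₁ L) n (X ∩ a • X) →
      Big ((univ : Set G).Definable₁ L) n (X ∩ b • X) →
      Big ((univ : Set G).Definable₁ L) n (X ∩ (a⁻¹ * b) • X) := by
    intro a b ha hb
    refine ((hfilt _ _ ha hb (definable₁_smul hmul hX.def b)).smul hmul a⁻¹).mono ?_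
      (hX.def.inter (definable₁_smul hmul hX.def _))
    rw [smul_set_inter, smul_set_inter, smul_smul, smul_smul, inv_mul_cancel, one_smul]
    exact inter_subset_inter_left _ inter_subset_right
  have hone : Big ((univ : Set G).Definable₁ L) n (X ∩ (1 : G) • X) := by simpa using hX
  have hinv : ∀ a : G, Big ((univ : Set G).Definable₁ L) n (X ∩ a • X) →
      Big ((univ : Set G).Definable₁ L) n (X ∩ a⁻¹ • X) := fun a ha => by
    simpa using hstab_mul a 1 ha hone
  let K : Subgroup G :=
    { carrier := {g | Big ((univ : Set G).Definable₁ L) n (X ∩ g • X)}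
      mul_mem' := fun {a b} ha hb => by simpa using hstab_mul a⁻¹ b (hinv a ha) hb
      one_mem' := hone
      inv_mem' := fun {a} ha => hinv a ha }
  have hKdef : DefSubgroup L K := by
    have hR : (univ : Set G).Definable L {v : Fin 2 → G | v 1 ∈ X ∧ (v 0)⁻¹ * v 1 ∈ X} :=
      (definable_mem hX.def (DefinableFun.proj L)).inter (definable_mem hX.def
        (definableFun_mul hmul (definableFun_inv hmul (DefinableFun.proj L))
          (DefinableFun.proj L)))
    have := hrk.definable_big hR hn'
    rw [DefSubgroup]
    convert! this using 1
    ext g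
    have : X ∩ g • X = {x | ![g, x] ∈ {v : Fin 2 → G | v 1 ∈ X ∧ (v 0)⁻¹ * v 1 ∈ X}} := by
      ext x
      simp [mem_smul_set_iff_inv_smul_mem]
    exact iff_of_eq (congrArg _ this)
  have hKindex : K.index ≠ 0 := by
    intro h0
    have hinf : Infinite (G ⧸ K) := by
      rwa [Subgroup.index_eq_zero_iff_infinite] at h0
    let q : ℕ → G := fun i => (Infinite.natEmbedding (G ⧸ K) i).out
    -- Translates of `X` by representatives of distinct cosets of `K` have non-generic intersection.
    have hq : ∀ i j, i ≠ j → ¬ Big ((univ : Set G).Definable₁ L) n (q i • X ∩ q j • X) := by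
      intro i j hij h
      have h2 := h.smul hmul (q i)⁻¹
      rw [smul_set_inter, smul_smul, smul_smul, inv_mul_cancel, one_smul] at h2
      have h3 : (q i)⁻¹ * q j ∈ K := h2
      rw [← QuotientGroup.eq, QuotientGroup.out_eq', QuotientGroup.out_eq'] at h3
      exact hij ((Infinite.natEmbedding (G ⧸ K)).injective h3)
    have hUdef : ∀ i, (univ : Set G).Definable₁ L (⋃ j ∈ Finset.range i, q j • X) := by
      intro i
      induction i with
      | zero => simpa using hempty
      | succ i ih =>
        rw [Finset.range_add_one, Finset.set_biUnion_insert]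
        exact hunion _ _ (definable₁_smul hmul hX.def _) ih
    -- Removing the earlier translates makes the sets disjoint; what is removed is a finite union of
    -- non-generic sets, so genericity survives.
    refine hn' ⟨definable_univ, fun i => (q i • X) \ ⋃ j ∈ Finset.range i, q j • X, ?_,
      fun i => ⟨?_, subset_univ _⟩⟩
    · refine (pairwise_disjoint_on _).2 fun a b hab => disjoint_left.2 fun x hx hx' => hx'.2 ?_
      exact mem_biUnion (Finset.mem_coe.2 (Finset.mem_range.2 hab)) hx.1
    · have h1 := hX.smul hmul (q i)
      rw [← inter_union_sdiff (q i • X) (⋃ j ∈ Finset.range i, q j • X)] at h1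
      rcases h1.of_union hinter ((definable₁_smul hmul hX.def _).inter (hUdef i))
        ((definable₁_smul hmul hX.def _).sdiff (hUdef i)) with h | h
      · rw [inter_iUnion₂] at h
        obtain ⟨j, hj, h⟩ := h.of_biUnion (A := fun j => q i • X ∩ q j • X) hinter hunion hempty _
          (fun j => (definable₁_smul hmul hX.def _).inter (definable₁_smul hmul hX.def _))
        exact (hq i j (Finset.mem_range.1 hj).ne' h).elim
      · exact h
  have hKtop : ∀ g, Big ((univ : Set G).Definable₁ L) n (X ∩ g • X) := fun g => by
    have : g ∈ K := by rw [hconn K hKdef hKindex]; trivial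
    exact this
  -- a set with finitely many translates covering the group is generic in `X`
  have hcover : ∀ (W : Set G) (r : Finset G), (univ : Set G).Definable₁ L W →
      ⋃ g ∈ r, g • W = univ → Big ((univ : Set G).Definable₁ L) n (X ∩ W) := by
    intro W r hW hr
    have h1 : Big ((univ : Set G).Definable₁ L) n (⋃ g ∈ r, X ∩ g • W) := by
      rwa [← inter_iUnion₂, hr, inter_univ]
    obtain ⟨g, -, h⟩ := h1.of_biUnion (A := fun g => X ∩ g • W) hinter hunion hempty _
      (fun g => hX.def.inter (definable₁_smul hmul hW g))
    -- Both `g • X` and `g • W` are generic in `X`, hence so is their intersection; translating by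
    -- `g⁻¹` gives a generic part of `X ∩ W`.
    have h2 := hfilt _ _ (hKtop g) h (definable₁_smul hmul hW g)
    refine (h2.smul hmul g⁻¹).mono ?_ (hX.def.inter hW)
    rw [smul_set_inter, smul_set_inter, smul_smul, smul_smul, inv_mul_cancel, one_smul, one_smul]
    exact inter_subset_inter_left _ inter_subset_right
  obtain ⟨x, hx, hxZ⟩ := (hfilt _ _ (hcover Y s hY hs) (hcover Z t hZ ht) hZ).nonempty
  exact ⟨x, hx.2, hxZ⟩

/-- By the chain condition there is a minimal definable subgroup of finite index in `H`; closure
under intersection makes it the least one. -/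
theorem component_spec (hG : IsGroupOfFiniteMorleyRank L G) {H : Subgroup G}
    (hH : DefSubgroup L H) :
    DefSubgroup L (component L H) ∧ component L H ≤ H ∧ (component L H).relIndex H ≠ 0 := by
  obtain ⟨rk, hrk⟩ := hG.exists_rank
  obtain ⟨K, hK, hmin⟩ := exists_minimal_defSubgroup hG.definable_mul hrk.exists_not_big
    (𝒮 := {K : Subgroup G | DefSubgroup L K ∧ K ≤ H ∧ K.relIndex H ≠ 0})
    ⟨H, hH, le_rfl, by simp⟩ (fun K hK => hK.1)
  have : component L H = K := by
    refine le_antisymm (sInf_le hK) (le_sInf fun M hM => ?_)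
    rw [← hmin (M ⊓ K) ⟨defSubgroup_inf hM.1 hK.1, inf_le_left.trans hM.2.1,
      Subgroup.relIndex_inf_ne_zero hM.2.2 hK.2.2⟩ inf_le_right]
    exact inf_le_left
  rw [this]
  exact hK

end Generic
-- A complex square root of a root of unity of `2`-power order again has `2`-power order.
theorem IsTwoTorus.exists_mul_self {T : Type*} [Group T] (hT : IsTwoTorus T) (t : T) :
    ∃ u, u * u = t := by
  obtain ⟨d, ⟨e⟩⟩ := hT
  have hP : ∀ x : PruferTwo, ∃ y, y * y = x := by
    rintro ⟨x, k, hk⟩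
    obtain ⟨z, hz⟩ := IsAlgClosed.exists_pow_nat_eq (x : ℂ) (n := 2) (by norm_num)
    have hz0 : z ≠ 0 := by
      rintro rfl
      exact x.ne_zero (by simpa using hz.symm)
    have hzx : Units.mk0 z hz0 ^ 2 = x := by
      ext
      simpa using hz
    refine ⟨⟨Units.mk0 z hz0, k + 1, ?_⟩, Subtype.ext ?_⟩
    · rw [pow_succ', pow_mul, hzx, hk]
    · simpa [sq] using hzx
  choose f hf using hP
  refine ⟨e.symm fun i => f (e t i), e.injective ?_⟩
  rw [map_mul, MulEquiv.apply_symm_apply]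
  ext1 i
  exact hf _

/-! ### Consequences of the centrality of `S`, and identities for commutators with `α`. -/

section CentralSylow

variable {G : Type*} [Group G] {S : Sylow 2 G}

/-- `S` is normal, so `S ⟨x⟩` is a `2`-group, and `S` is maximal. -/
theorem mem_sylow_of_pow_eq_one (hS : (S : Subgroup G) ≤ Subgroup.center G) {x : G} {k : ℕ}
    (hx : x ^ 2 ^ k = 1) : x ∈ S := by
  have : Fact (Nat.Prime 2) := ⟨Nat.prime_two⟩
  have hxp : IsPGroup 2 (Subgroup.zpowers x) :=
    IsPGroup.iff_orderOf.2 fun y => by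
      obtain ⟨m, hm⟩ := Subgroup.mem_zpowers_iff.1 y.2
      have : (y : G) ^ 2 ^ k = 1 := by
        rw [← hm, ← zpow_natCast, ← zpow_mul, mul_comm, zpow_mul, zpow_natCast, hx, one_zpow]
      obtain ⟨n, -, hn⟩ := (Nat.dvd_prime_pow Nat.prime_two).1 (orderOf_dvd_of_pow_eq_one this)
      exact ⟨n, by rw [← Subgroup.orderOf_coe, hn]⟩
  have hnormal : (S : Subgroup G).Normal := ⟨fun n hn g => by
    rw [Subgroup.mem_center_iff.1 (hS hn) g, mul_inv_cancel_right]; exact hn⟩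
  have := S.is_maximal' (S.isPGroup'.to_sup_of_normal_left hxp) le_sup_left
  exact this.le (Subgroup.mem_sup_right (Subgroup.mem_zpowers x))

theorem exists_pow_eq_one_of_mem_sylow {x : G} (hx : x ∈ S) : ∃ k : ℕ, x ^ 2 ^ k = 1 := by
  obtain ⟨k, hk⟩ := S.isPGroup' ⟨x, hx⟩
  exact ⟨k, congrArg Subtype.val hk⟩

theorem apply_mem_sylow (hS : (S : Subgroup G) ≤ Subgroup.center G) (α : G ≃* G) {x : G}
    (hx : x ∈ S) : α x ∈ S := by
  obtain ⟨k, hk⟩ := exists_pow_eq_one_of_mem_sylow hx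
  exact mem_sylow_of_pow_eq_one hS (k := k) (by rw [← map_pow, hk, map_one])

/-- On the central subgroup `S` the map `s ↦ [s, α]` is multiplicative, so its image is already a
subgroup. -/
theorem mem_commSubgroup_iff (hS : (S : Subgroup G) ≤ Subgroup.center G) {α : G ≃* G} {x : G} :
    x ∈ commSubgroup (S : Subgroup G) α ↔ ∃ s ∈ S, x = s⁻¹ * α s := by
  refine ⟨fun hx => ?_, fun ⟨s, hs, h⟩ => Subgroup.subset_closure ⟨s, hs, h⟩⟩
  have hc : ∀ s ∈ S, ∀ g, g * s = s * g := fun s hs => Subgroup.mem_center_iff.1 (hS hs)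
  induction hx using Subgroup.closure_induction with
  | mem x hx => exact hx
  | one => exact ⟨1, one_mem _, by simp⟩
  | mul x y _ _ hx hy =>
    obtain ⟨s, hs, rfl⟩ := hx
    obtain ⟨r, hr, rfl⟩ := hy
    refine ⟨s * r, mul_mem hs hr, ?_⟩
    have h : Commute (α s) r⁻¹ := hc _ (inv_mem hr) _
    rw [map_mul, mul_inv_rev, h.mul_mul_mul_comm, hc _ (inv_mem hr)]
  | inv x _ hx =>
    obtain ⟨s, hs, rfl⟩ := hx
    refine ⟨s⁻¹, inv_mem hs, ?_⟩
    rw [mul_inv_rev, inv_inv, map_inv, hc s hs]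

theorem commSubgroup_le (hS : (S : Subgroup G) ≤ Subgroup.center G) {α : G ≃* G} :
    commSubgroup (S : Subgroup G) α ≤ S := fun x hx => by
  obtain ⟨s, hs, rfl⟩ := (mem_commSubgroup_iff hS).1 hx
  exact mul_mem (inv_mem hs) (apply_mem_sylow hS α hs)

theorem mul_mem_commSet (hS : (S : Subgroup G) ≤ Subgroup.center G) {α : G ≃* G} {x r : G}
    (hx : x ∈ commSet α) (hr : r ∈ commSubgroup (S : Subgroup G) α) : x * r ∈ commSet α := by
  obtain ⟨g, rfl⟩ := hx
  obtain ⟨s, hs, rfl⟩ := (mem_commSubgroup_iff hS).1 hr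
  refine ⟨g * s, ?_⟩
  have hc := Subgroup.mem_center_iff.1 (hS (inv_mem hs))
  have h : Commute (α g) s⁻¹ := hc _
  rw [map_mul, mul_inv_rev, h.mul_mul_mul_comm, hc]

theorem commSubgroup_subset_commSet (hS : (S : Subgroup G) ≤ Subgroup.center G) {α : G ≃* G} :
    (commSubgroup (S : Subgroup G) α : Set G) ⊆ commSet α := fun r hr => by
  simpa using mul_mem_commSet hS (x := 1) ⟨1, by simp⟩ hr

theorem mem_omegaTwo_commSubgroup_iff (hS : (S : Subgroup G) ≤ Subgroup.center G) {α : G ≃* G}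
    {x : G} : x ∈ omegaTwo (commSubgroup (S : Subgroup G) α) ↔
      x ∈ commSubgroup (S : Subgroup G) α ∧ x * x = 1 := by
  constructor
  · intro hx
    induction hx using Subgroup.closure_induction with
    | mem x hx => exact ⟨hx.1, by rw [← sq, ← hx.2, pow_orderOf_eq_one]⟩
    | one => exact ⟨one_mem _, mul_one 1⟩
    | mul x y _ _ hx hy =>
      refine ⟨mul_mem hx.1 hy.1, ?_⟩
      rw [mul_assoc, ← mul_assoc y,
        Subgroup.mem_center_iff.1 (hS (commSubgroup_le hS hx.1)) y, mul_assoc, hy.2, mul_one, hx.2]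
    | inv x _ hx => exact ⟨inv_mem hx.1, by rw [← mul_inv_rev, hx.2, inv_one]⟩
  · rintro ⟨hx, h⟩
    by_cases h1 : x = 1
    · exact h1 ▸ one_mem _
    · exact Subgroup.subset_closure ⟨hx, orderOf_eq_prime (by rw [sq, h]) h1⟩

theorem apply_commSet {α : G ≃* G} (hα : Function.Involutive α) {x : G} (hx : x ∈ commSet α) :
    α x = x⁻¹ := by
  obtain ⟨g, rfl⟩ := hx
  rw [map_mul, map_inv, hα g, mul_inv_rev, inv_inv]

theorem inv_mem_commSet {α : G ≃* G} (hα : Function.Involutive α) {x : G} (hx : x ∈ commSet α) :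
    x⁻¹ ∈ commSet α := by
  obtain ⟨g, rfl⟩ := hx
  exact ⟨α g, by rw [hα g, mul_inv_rev, inv_inv]⟩

/-- If `x = [g, α]`, then `[g * h ^ 2, α] = h⁻² x h⁻² = x h⁻⁴`. -/
theorem mul_pow_four_inv_mem_commSet {α : G ≃* G} {x h : G} (hx : x ∈ commSet α)
    (hhx : Commute h x) (hh : α h = h⁻¹) : x * (h ^ 4)⁻¹ ∈ commSet α := by
  obtain ⟨g, rfl⟩ := hx
  refine ⟨g * h ^ 2, ?_⟩
  have h1 : (h ^ 4)⁻¹ = (h ^ 2)⁻¹ * (h ^ 2)⁻¹ := by rw [← mul_inv_rev, ← pow_add]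
  rw [h1, ← mul_assoc, ← ((hhx.pow_left 2).inv_left).eq, map_mul, map_pow, hh, inv_pow,
    mul_inv_rev]
  simp only [mul_assoc]

end CentralSylow

/-! ### Double centralizers as abelian overgroups of single elements. -/

section Bicentralizer

variable {G : Type*} [Group G]

/-- The double centralizer of an element. -/
abbrev bicent (x : G) : Subgroup G := Subgroup.centralizer (Subgroup.centralizer {x} : Set G)

theorem commute_of_mem_bicent {x y z : G} (hz : z ∈ bicent x) (hy : Commute x y) :
    Commute z y :=
  (Subgroup.mem_centralizer_iff.1 hz y (Subgroup.mem_centralizer_singleton_iff.2 hy.symm)).symm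

theorem self_mem_bicent (x : G) : x ∈ bicent x :=
  Subgroup.mem_centralizer_iff.2 fun _ hy => Subgroup.mem_centralizer_singleton_iff.1 hy

theorem commute_of_mem_bicent_bicent {x y z : G} (hy : y ∈ bicent x) (hz : z ∈ bicent x) :
    Commute y z :=
  commute_of_mem_bicent hy (commute_of_mem_bicent hz (Commute.refl x)).symm

end Bicentralizer

/-! ### Square roots in `{G, α}`: existence and uniqueness up to `Ω₂([S, α])`. -/

section FiniteMorleyRank

variable {L : FirstOrder.Language.{u, v}} {G : Type w} [Group G] [L.Structure G]

theorem defSubgroup_bicent (hG : IsGroupOfFiniteMorleyRank L G) (x : G) :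
    DefSubgroup L (bicent x) :=
  definable₁_centralizer hG.definable_mul
    (definable₁_centralizer hG.definable_mul (definable₁_singleton x))

/-- In a commutative definable subgroup the descending chain of the subgroups of `2 ^ n`-th powers
is stationary. -/
theorem exists_pow_eq_pow_of_commute (hG : IsGroupOfFiniteMorleyRank L G) {A : Subgroup G}
    (hA : DefSubgroup L A) (hcomm : ∀ x ∈ A, ∀ y ∈ A, Commute x y) :
    ∃ j, ∀ k, ∀ z ∈ A, ∃ h ∈ A, h ^ 2 ^ (j + k) = z ^ 2 ^ j := by
  obtain ⟨rk, hrk⟩ := hG.exists_rank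
  let P : ℕ → Subgroup G := fun n =>
    { carrier := (fun x => x ^ n) '' A
      mul_mem' := by
        rintro _ _ ⟨x, hx, rfl⟩ ⟨y, hy, rfl⟩
        exact ⟨x * y, mul_mem hx hy, (hcomm x hx y hy).mul_pow n⟩
      one_mem' := ⟨1, one_mem _, one_pow n⟩
      inv_mem' := by
        rintro _ ⟨x, hx, rfl⟩
        exact ⟨x⁻¹, inv_mem hx, inv_pow x n⟩ }
  obtain ⟨-, ⟨j, rfl⟩, hj⟩ := exists_minimal_defSubgroup hG.definable_mul hrk.exists_not_big
    (Set.range_nonempty fun j => P (2 ^ j))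
    (by rintro _ ⟨j, rfl⟩; exact definable₁_pow hG.definable_mul hA _)
  refine ⟨j, fun k z hz => ?_⟩
  have hle : P (2 ^ (j + k)) ≤ P (2 ^ j) := by
    rintro _ ⟨x, hx, rfl⟩
    exact ⟨x ^ 2 ^ k, pow_mem hx _, by
      change (x ^ 2 ^ k) ^ 2 ^ j = x ^ 2 ^ (j + k)
      rw [← pow_mul, ← pow_add, add_comm]⟩
  have hz' : z ^ 2 ^ j ∈ P (2 ^ (j + k)) := by
    rw [show P (2 ^ (j + k)) = P (2 ^ j) from hj _ ⟨j + k, rfl⟩ hle]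
    exact ⟨z, hz, rfl⟩
  exact hz'

variable {S : Sylow 2 G} {α : G ≃* G}

/-- If `t = [g, α]` with `t ^ 2^n = 1`, then `g ^ 2^n` is fixed by `α`. The chain condition in the
fixed points of `bicent g` yields a fixed `h` such that `g * h⁻¹` is a `2`-element; it lies in `S`
and has commutator `t`. -/
theorem mem_commSubgroup_of_mem_commSet (hG : IsGroupOfFiniteMorleyRank L G)
    (hS : (S : Subgroup G) ≤ Subgroup.center G)
    (hα : (Set.univ : Set G).Definable₂ L {p : G × G | α p.1 = p.2}) {t : G}
    (ht : t ∈ commSet α) (htS : t ∈ S) : t ∈ commSubgroup (S : Subgroup G) α := by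
  obtain ⟨g, hg⟩ := ht
  obtain ⟨n, hn⟩ := exists_pow_eq_one_of_mem_sylow htS
  have hαg : α g = g * t := by rw [hg, mul_inv_cancel_left]
  have hgt : Commute g t := Subgroup.mem_center_iff.1 (hS htS) g
  obtain ⟨j, hj⟩ := exists_pow_eq_pow_of_commute hG
    (defSubgroup_inf (defSubgroup_bicent hG g) (defSubgroup_fixedPts hα))
    fun x hx y hy => commute_of_mem_bicent_bicent hx.1 hy.1
  obtain ⟨h, ⟨hh, hαh⟩, hpow⟩ := hj n (g ^ 2 ^ n) ⟨pow_mem (self_mem_bicent g) _, by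
    change α (g ^ 2 ^ n) = g ^ 2 ^ n
    rw [map_pow, hαg, hgt.mul_pow, hn, mul_one]⟩
  have hgh : Commute g h := (commute_of_mem_bicent hh (Commute.refl g)).symm
  refine (mem_commSubgroup_iff hS).2 ⟨g * h⁻¹, mem_sylow_of_pow_eq_one hS (k := j + n) ?_, ?_⟩
  · rw [hgh.inv_right.mul_pow, inv_pow, hpow, ← pow_mul, ← pow_add, add_comm n, mul_inv_cancel]
  · have hαh : α h = h := hαh
    rw [map_mul, map_inv, hαh, hαg, mul_inv_rev, inv_inv, mul_assoc, mul_assoc,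
      inv_mul_cancel_left, ← mul_assoc, Subgroup.mem_center_iff.1 (hS htS) h, mul_inv_cancel_right]

/-- A commutator `[g, α]` is, up to an element of `[S, α]`, a fourth power of an `α`-inverted
element of its double centralizer. -/
theorem exists_eq_mul_pow_four (hG : IsGroupOfFiniteMorleyRank L G)
    (hS : (S : Subgroup G) ≤ Subgroup.center G)
    (hα : (Set.univ : Set G).Definable₂ L {p : G × G | α p.1 = p.2})
    (hα' : Function.Involutive α) {x : G} (hx : x ∈ commSet α) :
    ∃ h ∈ bicent x, α h = h⁻¹ ∧ ∃ t ∈ commSubgroup (S : Subgroup G) α, x = t * h ^ 4 := by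
  let A : Subgroup G :=
    { carrier := (bicent x : Set G) ∩ {z | α z = z⁻¹}
      mul_mem' := by
        rintro y z ⟨hy, hy'⟩ ⟨hz, hz'⟩
        refine ⟨mul_mem hy hz, ?_⟩
        rw [Set.mem_ofPred_eq] at hy' hz' ⊢
        rw [map_mul, hy', hz', ← mul_inv_rev, (commute_of_mem_bicent_bicent hy hz).eq]
      one_mem' := ⟨one_mem _, by simp⟩
      inv_mem' := by
        rintro y ⟨hy, hy'⟩
        refine ⟨inv_mem hy, ?_⟩
        rw [Set.mem_ofPred_eq] at hy' ⊢
        rw [map_inv, hy'] }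
  have hA : DefSubgroup L A :=
    (defSubgroup_bicent hG x).inter (definable₁_inverted hG.definable_mul hα)
  obtain ⟨j, hj⟩ := exists_pow_eq_pow_of_commute hG hA
    fun x hx y hy => commute_of_mem_bicent_bicent hx.1 hy.1
  -- The exponent `2` provides a fourth power: its root `h ^ 2 = [h⁻¹, α]` is then itself in `{G,
  -- α}`.
  obtain ⟨h, ⟨hh, hαh⟩, hpow⟩ := hj 2 x ⟨self_mem_bicent x, apply_commSet hα' hx⟩
  have hαh : α h = h⁻¹ := hαh
  have hxh : Commute h x := commute_of_mem_bicent hh (Commute.refl x)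
  refine ⟨h, hh, hαh, x * (h ^ 4)⁻¹, mem_commSubgroup_of_mem_commSet hG hS hα ?_ ?_, by simp⟩
  · exact mul_pow_four_inv_mem_commSet hx hxh hαh
  · refine mem_sylow_of_pow_eq_one hS (k := j) ?_
    rw [((hxh.pow_left 4).symm.inv_right).mul_pow, inv_pow, ← pow_mul, ← hpow, pow_add,
      mul_comm (2 ^ j)]
    norm_num

/-- Write `x = [s, α] * h ^ 4` and `s = r ^ 2` in the torus; then `h ^ 2 * [r, α]` is a root. -/
theorem exists_mul_self_eq (hG : IsGroupOfFiniteMorleyRank L G) (hST : IsTwoTorus S)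
    (hS : (S : Subgroup G) ≤ Subgroup.center G)
    (hα : (Set.univ : Set G).Definable₂ L {p : G × G | α p.1 = p.2})
    (hα' : Function.Involutive α) {x : G} (hx : x ∈ commSet α) :
    ∃ y ∈ commSet α, y * y = x := by
  obtain ⟨h, -, hαh, t, ht, rfl⟩ := exists_eq_mul_pow_four hG hS hα hα' hx
  obtain ⟨s, hs, rfl⟩ := (mem_commSubgroup_iff hS).1 ht
  obtain ⟨⟨r, hr⟩, hrs⟩ := hST.exists_mul_self ⟨s, hs⟩
  obtain rfl : r * r = s := congrArg Subtype.val hrs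
  have hu : r⁻¹ * α r ∈ commSubgroup (S : Subgroup G) α := (mem_commSubgroup_iff hS).2 ⟨r, hr, rfl⟩
  have hc := Subgroup.mem_center_iff.1 (hS (commSubgroup_le hS hu))
  have hrc := Subgroup.mem_center_iff.1 (hS hr)
  refine ⟨h ^ 2 * (r⁻¹ * α r), mul_mem_commSet hS ⟨h⁻¹, ?_⟩ hu, ?_⟩
  · rw [map_inv, hαh, inv_inv, sq]
  · have h1 : (r * r)⁻¹ * α (r * r) = (r⁻¹ * α r) * (r⁻¹ * α r) := by
      have hcr : Commute r⁻¹ (α r) := (show Commute (α r) r from hrc _).symm.inv_left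
      rw [map_mul, mul_inv_rev, hcr.mul_mul_mul_comm]
    have hcu : Commute (h ^ 2) (r⁻¹ * α r) := hc _
    rw [h1, ← sq, ← sq, hcu.mul_pow, (hcu.pow_pow 2 2).eq, ← pow_mul]

theorem exists_eq_mul_of_mul_self_eq (hG : IsGroupOfFiniteMorleyRank L G)
    (hS : (S : Subgroup G) ≤ Subgroup.center G)
    (hα : (Set.univ : Set G).Definable₂ L {p : G × G | α p.1 = p.2})
    (hα' : Function.Involutive α) {x y : G} (hx : x ∈ commSet α) (hy : y ∈ commSet α)
    (hxy : x * x = y * y) :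
    ∃ r ∈ omegaTwo (commSubgroup (S : Subgroup G) α), x = y * r := by
  -- Modulo the central `S`, `x` equals an element `h` of the double centralizer of `x² = y²`, and
  -- `y` commutes with `h`.
  have hcomm : Commute x y := by
    obtain ⟨j, hj⟩ := exists_pow_eq_pow_of_commute hG (defSubgroup_bicent hG (x * x))
      fun x hx y hy => commute_of_mem_bicent_bicent hx hy
    obtain ⟨h, hh, hpow⟩ := hj 1 (x * x) (self_mem_bicent _)
    have hhx : Commute h x := commute_of_mem_bicent hh ((Commute.refl x).mul_left (Commute.refl x))
    have hhy : Commute h y := commute_of_mem_bicent hh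
      (hxy ▸ (Commute.refl y).mul_left (Commute.refl y))
    have hmem : x * h⁻¹ ∈ S := mem_sylow_of_pow_eq_one hS (k := j + 1) (by
      rw [hhx.symm.inv_right.mul_pow, inv_pow, hpow, ← sq, ← pow_mul, pow_succ', mul_inv_cancel])
    have : x = (x * h⁻¹) * h := by simp
    rw [this]
    exact Commute.mul_left (Subgroup.mem_center_iff.1 (hS hmem) y).symm hhy
  have hr2 : (y⁻¹ * x) * (y⁻¹ * x) = 1 := by
    rw [← sq, hcomm.symm.inv_left.mul_pow, sq x, hxy, inv_pow, sq, inv_mul_cancel]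
  have hrS : y⁻¹ * x ∈ S := mem_sylow_of_pow_eq_one hS (k := 1) (by rw [pow_one, sq, hr2])
  refine ⟨y⁻¹ * x, (mem_omegaTwo_commSubgroup_iff hS).2 ⟨?_, hr2⟩, by simp⟩
  -- It remains to move `r = y⁻¹ * x` from `S` into `[S, α]`: with `y = t * h ^ 4`, the commutator
  -- `x * h⁻⁴` equals `t * r`, which lies in `S` and hence in `[S, α]`.
  obtain ⟨h, hh, hαh, t, ht, hyt⟩ := exists_eq_mul_pow_four hG hS hα hα' hy
  have hhx : Commute h x := commute_of_mem_bicent hh hcomm.symm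
  have hmem : x * (h ^ 4)⁻¹ ∈ commSet α := mul_pow_four_inv_mem_commSet hx hhx hαh
  have heq : x * (h ^ 4)⁻¹ = t * (y⁻¹ * x) := by
    have h4 : h ^ 4 = t⁻¹ * y := by rw [hyt, inv_mul_cancel_left]
    rw [h4, mul_inv_rev, inv_inv, ← mul_assoc, hcomm.inv_right.eq,
      Subgroup.mem_center_iff.1 (hS (commSubgroup_le hS ht))]
  have htS := commSubgroup_le hS ht
  have := mem_commSubgroup_of_mem_commSet hG hS hα hmem (heq ▸ mul_mem htS hrS)
  rw [heq] at this
  exact (Subgroup.mul_mem_cancel_left _ ht).1 this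

end FiniteMorleyRank

/-! ### The factorization, its fibres, the involutions, and the connected case. -/

section Decomposition

variable {L : FirstOrder.Language.{u, v}} {G : Type w} [Group G] [L.Structure G]
  {S : Sylow 2 G} {α : G ≃* G}

theorem exists_fixedPts_mul_commSet (hG : IsGroupOfFiniteMorleyRank L G) (hST : IsTwoTorus S)
    (hS : (S : Subgroup G) ≤ Subgroup.center G)
    (hα : (Set.univ : Set G).Definable₂ L {p : G × G | α p.1 = p.2})
    (hα' : Function.Involutive α) (g : G) :
    ∃ a ∈ fixedPts α, ∃ x ∈ commSet α, a * x = g := by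
  obtain ⟨y, hy, hyg⟩ := exists_mul_self_eq hG hST hS hα hα' (x := g⁻¹ * α g) ⟨g, rfl⟩
  refine ⟨g * y, ?_, y⁻¹, inv_mem_commSet hα' hy, by simp⟩
  have hαg : α g = g * (y * y) := by rw [hyg, mul_inv_cancel_left]
  change α (g * y) = g * y
  rw [map_mul, apply_commSet hα' hy, hαg, mul_assoc, mul_inv_cancel_right]

theorem inv_mul_apply_of_fixedPts_mul_commSet (hα' : Function.Involutive α) {a x : G}
    (ha : a ∈ fixedPts α) (hx : x ∈ commSet α) : (a * x)⁻¹ * α (a * x) = (x * x)⁻¹ := by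
  have ha : α a = a := ha
  rw [map_mul, ha, apply_commSet hα' hx]
  group

theorem apply_omegaTwo (hS : (S : Subgroup G) ≤ Subgroup.center G)
    (hα' : Function.Involutive α) {r : G}
    (hr : r ∈ omegaTwo (commSubgroup (S : Subgroup G) α)) : α r = r := by
  obtain ⟨h1, h2⟩ := (mem_omegaTwo_commSubgroup_iff hS).1 hr
  rw [apply_commSet hα' (commSubgroup_subset_commSet hS h1), inv_eq_of_mul_eq_one_left h2]

/-- Two factorizations of an element along `G⁺ · {G, α}` differ by an element of `Ω₂([S, α])`. -/
theorem exists_omegaTwo_of_mul_eq_mul (hG : IsGroupOfFiniteMorleyRank L G)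
    (hS : (S : Subgroup G) ≤ Subgroup.center G)
    (hα : (Set.univ : Set G).Definable₂ L {p : G × G | α p.1 = p.2})
    (hα' : Function.Involutive α) {a b x y : G} (ha : a ∈ fixedPts α) (hb : b ∈ fixedPts α)
    (hx : x ∈ commSet α) (hy : y ∈ commSet α) (h : a * x = b * y) :
    ∃ r ∈ omegaTwo (commSubgroup (S : Subgroup G) α), a = b * r⁻¹ ∧ x = y * r := by
  have hxy : x * x = y * y := by
    rw [← inv_inj, ← inv_mul_apply_of_fixedPts_mul_commSet hα' ha hx, h,
      inv_mul_apply_of_fixedPts_mul_commSet hα' hb hy]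
  obtain ⟨r, hr, rfl⟩ := exists_eq_mul_of_mul_self_eq hG hS hα hα' hx hy hxy
  refine ⟨r, hr, ?_, rfl⟩
  have hrS := commSubgroup_le hS ((mem_omegaTwo_commSubgroup_iff hS).1 hr).1
  have hc := Subgroup.mem_center_iff.1 (hS hrS) y
  rw [hc, ← mul_assoc] at h
  rw [← mul_right_cancel h, mul_inv_cancel_right]

theorem nonempty_fibre_equiv_omegaTwo (hG : IsGroupOfFiniteMorleyRank L G) (hST : IsTwoTorus S)
    (hS : (S : Subgroup G) ≤ Subgroup.center G)
    (hα : (Set.univ : Set G).Definable₂ L {p : G × G | α p.1 = p.2})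
    (hα' : Function.Involutive α) (g : G) :
    Nonempty ({p : fixedPts α × commSet α // (p.1 : G) * (p.2 : G) = g} ≃
      omegaTwo (commSubgroup (S : Subgroup G) α)) := by
  obtain ⟨b, hb, y, hy, hbyg⟩ := exists_fixedPts_mul_commSet hG hST hS hα hα' g
  refine ⟨(Equiv.ofBijective (fun r : omegaTwo (commSubgroup (S : Subgroup G) α) =>
    (⟨(⟨b * (r : G)⁻¹, mul_mem hb (inv_mem (apply_omegaTwo hS hα' r.2))⟩,
      ⟨y * r, mul_mem_commSet hS hy ((mem_omegaTwo_commSubgroup_iff hS).1 r.2).1⟩), ?_⟩ :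
      {p : fixedPts α × commSet α // (p.1 : G) * (p.2 : G) = g})) ⟨?_, ?_⟩).symm⟩
  · have hrS := commSubgroup_le hS ((mem_omegaTwo_commSubgroup_iff hS).1 r.2).1
    change b * (r : G)⁻¹ * (y * r) = g
    rw [Subgroup.mem_center_iff.1 (hS hrS) y, mul_assoc, inv_mul_cancel_left, hbyg]
  · intro r s hrs
    have := congrArg (fun p => (p.1.2 : G)) hrs
    exact Subtype.ext (mul_left_cancel this)
  · rintro ⟨⟨⟨a, ha⟩, ⟨x, hx⟩⟩, hax⟩
    obtain ⟨r, hr, rfl, rfl⟩ :=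
      exists_omegaTwo_of_mul_eq_mul hG hS hα hα' ha hb hx hy (hax.trans hbyg.symm)
    exact ⟨⟨r, hr⟩, rfl⟩

theorem involutions_commSet_union_one (hG : IsGroupOfFiniteMorleyRank L G)
    (hS : (S : Subgroup G) ≤ Subgroup.center G)
    (hα : (Set.univ : Set G).Definable₂ L {p : G × G | α p.1 = p.2}) :
    involutions (commSet α) ∪ {1} = (omegaTwo (commSubgroup (S : Subgroup G) α) : Set G) := by
  ext x
  rw [SetLike.mem_coe, mem_omegaTwo_commSubgroup_iff hS]
  constructor
  · rintro (⟨hx, hord⟩ | rfl)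
    · have h2 : x ^ 2 = 1 := hord ▸ pow_orderOf_eq_one x
      exact ⟨mem_commSubgroup_of_mem_commSet hG hS hα hx
        (mem_sylow_of_pow_eq_one hS (k := 1) (by rwa [pow_one])), by rwa [← sq]⟩
    · exact ⟨one_mem _, mul_one 1⟩
  · rintro ⟨hx, h⟩
    by_cases h1 : x = 1
    · exact Or.inr h1
    · exact Or.inl ⟨commSubgroup_subset_commSet hS hx, orderOf_eq_prime (by rw [sq, h]) h1⟩

theorem component_mul_commSet (hG : IsGroupOfFiniteMorleyRank L G) (hST : IsTwoTorus S)
    (hS : (S : Subgroup G) ≤ Subgroup.center G)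
    (hα : (Set.univ : Set G).Definable₂ L {p : G × G | α p.1 = p.2})
    (hα' : Function.Involutive α) (hconn : IsConnectedGroup L G) :
    (component L (fixedPts α) : Set G) * commSet α = Set.univ := by
  classical
  obtain ⟨hHdef, hHle, hHidx⟩ := component_spec hG (defSubgroup_fixedPts hα)
  set H := component L (fixedPts α)
  have hYdef := definable₁_mul hG.definable_mul hHdef (definable₁_commSet hG.definable_mul hα)
  have hfin : Finite (fixedPts α ⧸ H.subgroupOf (fixedPts α)) :=
    (Subgroup.finiteIndex_iff_finite_quotient).1 ⟨hHidx⟩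
  have := Fintype.ofFinite (fixedPts α ⧸ H.subgroupOf (fixedPts α))
  let s : Finset G := Finset.univ.image fun q : fixedPts α ⧸ H.subgroupOf (fixedPts α) =>
    ((Quotient.out q : fixedPts α) : G)
  have hs : ⋃ g ∈ s, g • ((H : Set G) * commSet α) = Set.univ := by
    refine Set.eq_univ_of_forall fun g => ?_
    obtain ⟨a, ha, x, hx, rfl⟩ := exists_fixedPts_mul_commSet hG hST hS hα hα' g
    let b : fixedPts α := Quotient.out (QuotientGroup.mk (s := H.subgroupOf (fixedPts α)) ⟨a, ha⟩)
    have hb : b⁻¹ * ⟨a, ha⟩ ∈ H.subgroupOf (fixedPts α) :=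
      QuotientGroup.eq.1 (QuotientGroup.out_eq' _)
    refine Set.mem_biUnion (x := (b : G)) (Finset.mem_image_of_mem _ (Finset.mem_univ _)) ?_
    exact ⟨(b : G)⁻¹ * a * x, Set.mul_mem_mul hb hx, by simp [mul_assoc]⟩
  refine Set.eq_univ_of_forall fun g => ?_
  obtain ⟨a, ha, x, hx, rfl⟩ := exists_fixedPts_mul_commSet hG hST hS hα hα' g
  -- The translate of the product set by `a` is covered by the same translates, after shifting the
  -- indices by `a⁻¹`.
  have hs' : ⋃ g ∈ s.image (· * a⁻¹), g • a • ((H : Set G) * commSet α) = Set.univ := by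
    rw [Finset.set_biUnion_finset_image]
    simpa only [smul_smul, inv_mul_cancel_right] using hs
  obtain ⟨_, ⟨_, ⟨h, hh, y, hy, rfl⟩, rfl⟩, h', hh', z, hz, hyz⟩ :=
    hconn.inter_nonempty hG (definable₁_smul hG.definable_mul hYdef a) hYdef hs' hs
  have hyz : h' * z = a * h * y := by simpa [mul_assoc] using hyz
  obtain ⟨r, hr, har, -⟩ := exists_omegaTwo_of_mul_eq_mul hG hS hα hα' (mul_mem ha (hHle hh))
    (hHle hh') hy hz hyz.symm
  -- `a = h' r⁻¹ h⁻¹` with `r` central, so `r⁻¹` can be moved into `{G, α}`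
  have hrT := inv_mem ((mem_omegaTwo_commSubgroup_iff hS).1 hr).1
  have hc := Subgroup.mem_center_iff.1 (hS (commSubgroup_le hS hrT))
  refine ⟨h' * h⁻¹, mul_mem hh' (inv_mem hh), x * r⁻¹, mul_mem_commSet hS hx hrT, ?_⟩
  have : a = h' * h⁻¹ * r⁻¹ := by
    rw [mul_assoc, hc h⁻¹, ← mul_assoc, ← har, mul_inv_cancel_right]
  change h' * h⁻¹ * (x * r⁻¹) = a * x
  rw [this, hc x, mul_assoc (h' * h⁻¹) r⁻¹]

end Decomposition

end FMR

theorem lemma3p3 {L : FirstOrder.Language.{u, v}} {G : Type w} [Group G] [L.Structure G]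
    (hG : FMR.IsGroupOfFiniteMorleyRank L G)
    (S : Sylow 2 G) (hS_torus : FMR.IsTwoTorus S)
    (hS_central : (S : Subgroup G) ≤ Subgroup.center G)
    (α : G ≃* G) (hα_def : (Set.univ : Set G).Definable₂ L {p : G × G | α p.1 = p.2})
    (hα_inv : Function.Involutive α) :
    (FMR.fixedPts α : Set G) * FMR.commSet α = Set.univ ∧
    (∀ g : G, Nonempty
      ({p : FMR.fixedPts α × FMR.commSet α // (p.1 : G) * (p.2 : G) = g} ≃
        FMR.omegaTwo (FMR.commSubgroup (S : Subgroup G) α))) ∧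
    FMR.involutions (FMR.commSet α) ∪ {1} =
      (FMR.omegaTwo (FMR.commSubgroup (S : Subgroup G) α) : Set G) ∧
    (FMR.IsConnectedGroup L G →
      (FMR.component L (FMR.fixedPts α) : Set G) * FMR.commSet α = Set.univ) := by
  refine ⟨Set.eq_univ_of_forall fun g => ?_,
    FMR.nonempty_fibre_equiv_omegaTwo hG hS_torus hS_central hα_def hα_inv,
    FMR.involutions_commSet_union_one hG hS_central hα_def,
    FMR.component_mul_commSet hG hS_torus hS_central hα_def hα_inv⟩
  obtain ⟨a, ha, x, hx, h⟩ :=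
    FMR.exists_fixedPts_mul_commSet hG hS_torus hS_central hα_def hα_inv g
  exact ⟨a, ha, x, hx, h⟩
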